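/- Let $\Gamma$ be a discrete group that has only finitely many finite subgroups up to conjugacy (FCP) and that is virtually torsion-free, i.e. has a torsion-free subgroup of finite index. Let $\mathbb K$ be a field of characteristic $0$ and let $\mathcal F$ be a family of finite subgroups of $\Gamma$, i.e. a non-empty collection of finite subgroups closed under conjugation and under passage to subgroups (for example the family of all finite subgroups). For a ring $A$ let $K_0(A)$, respectively $G(A)$, be the abelian group with generators $[M]$, for $M$ a finitely generated projective, respectively finitely generated, left $A$-module, and relations $[M]=[M']+[M'']$ for the short exact sequences $0\to M'\to M\to M''\to 0$ of such modules; let $G^f(\mathbb K[\Gamma])$ be the group defined in the same way from the $\mathbb K[\Gamma]$-modules that are finite-dimensional over $\mathbb K$. Let $$G_{\mathcal F}(\mathbb K[\Gamma])=\lim_{H\in\mathcal F}G(\mathbb K[H])\subseteq\prod_{H\in\mathcal F}G(\mathbb K[H])$$ be the group of those $(x_H)_{H\in\mathcal F}$ such that $\mathrm{res}^K_H(x_K)=x_H$ whenever $H\subseteq K$ are in $\mathcal F$, and $C_\gamma^*(x_{\gamma H\gamma^{-1}})=x_H$ for all $H\in\mathcal F$ and $\gamma\in\Gamma$, where $C_\gamma:H\to\gamma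 H\gamma^{-1}$ is conjugation by $\gamma$. Let $\overline G_{\mathcal F}(\mathbb K[\Gamma])$ be the image of $\prod_{H\in\mathcal F}\mathrm{res}^\Gamma_H: G^f(\mathbb K[\Gamma])\to\prod_{H\in\mathcal F}G(\mathbb K[H])$; it is contained in $G_{\mathcal F}(\mathbb K[\Gamma])$, and $j_{\mathcal F}:\overline G_{\mathcal F}(\mathbb K[\Gamma])\to G_{\mathcal F}(\mathbb K[\Gamma])$ denotes the inclusion. Then $$\dim_{\mathbb Q}K_0(\mathbb K[\Gamma])\otimes\mathbb Q\ \ge\ \dim_{\mathbb Q}(\mathrm{im}\,j_{\mathcal F})\otimes\mathbb Q .$$ Moreover, if $K_0(\mathbb C[\Gamma])\cong\mathbb Z$ as abelian groups, then $\Gamma$ is torsion-free. -/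

import Mathlib

universe u v w

noncomputable section

namespace DiscreteGroupK

section Grothendieck

variable {A : Type w} [Ring A]

/-- The relations `[M] = [M'] + [M'']` coming from the short exact sequences
`0 → M' → M → M'' → 0` of left `A`-modules that all satisfy `P`. -/
def exactRelations (P : ModuleCat.{w} A → Prop) : Set (FreeAbelianGroup {M : ModuleCat.{w} A // P M}) :=
  {x | ∃ (M' M M'' : {M : ModuleCat.{w} A // P M})
      (f : M'.1 →ₗ[A] M.1) (g : M.1 →ₗ[A] M''.1),
      Function.Injective f ∧ Function.Exact f g ∧ Function.Surjective g ∧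
      x = FreeAbelianGroup.of M - (FreeAbelianGroup.of M' + FreeAbelianGroup.of M'')}

/-- The Grothendieck group of the left `A`-modules that satisfy `P`: generators `[M]`, one relation
for every short exact sequence of such modules. (Finitely generated `A`-modules all have copies in
the universe of `A`.) -/
def GrothGroup (P : ModuleCat.{w} A → Prop) : Type (w + 1) :=
  FreeAbelianGroup {M : ModuleCat.{w} A // P M} ⧸ AddSubgroup.closure (exactRelations P)

instance (P : ModuleCat.{w} A → Prop) : AddCommGroup (GrothGroup P) :=
  inferInstanceAs (AddCommGroup
    (FreeAbelianGroup {M : ModuleCat.{w} A // P M} ⧸ AddSubgroup.closure (exactRelations P)))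

/-- The class `[M]`. -/
def GrothGroup.cls (P : ModuleCat.{w} A → Prop) (M : ModuleCat.{w} A) (hM : P M) : GrothGroup P :=
  QuotientAddGroup.mk' (AddSubgroup.closure (exactRelations P)) (FreeAbelianGroup.of ⟨M, hM⟩)

theorem GrothGroup.cls_exact {P : ModuleCat.{w} A → Prop} {M' M M'' : ModuleCat.{w} A}
    (hM' : P M') (hM : P M) (hM'' : P M'') (f : M' →ₗ[A] M) (g : M →ₗ[A] M'')
    (hf : Function.Injective f) (hfg : Function.Exact f g) (hg : Function.Surjective g) :
    cls P M hM = cls P M' hM' + cls P M'' hM'' := by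
  rw [← sub_eq_zero]
  exact (QuotientAddGroup.eq_zero_iff
    (N := AddSubgroup.closure (exactRelations P)) _).2
    (AddSubgroup.subset_closure ⟨⟨M', hM'⟩, ⟨M, hM⟩, ⟨M'', hM''⟩, f, g, hf, hfg, hg, rfl⟩)

/-- Isomorphic modules have the same class. -/
theorem GrothGroup.cls_congr {P : ModuleCat.{w} A → Prop} {M N : ModuleCat.{w} A}
    (hM : P M) (hN : P N) (hP : P (ModuleCat.of A PUnit.{w + 1})) (e : M ≃ₗ[A] N) :
    cls P M hM = cls P N hN := by
  have h0 : cls P _ hP = 0 := by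
    have h := cls_exact hP hP hP (0 : ModuleCat.of A PUnit.{w + 1} →ₗ[A] _) 0
      (fun a b _ => Subsingleton.elim (α := PUnit) a b)
      (fun a => ⟨fun _ => ⟨0, rfl⟩, fun _ => rfl⟩)
      (fun a => ⟨0, rfl⟩)
    simpa using h
  have h := cls_exact hM hN hP (e : M →ₗ[A] N) 0 e.injective
    (fun a => ⟨fun _ => ⟨e.symm a, by simp⟩, fun _ => rfl⟩) (fun a => ⟨0, rfl⟩)
  rw [h, h0, add_zero]

/-- Restriction of scalars along `φ : A → B` on Grothendieck groups, `[M] ↦ [φ^* M]`. -/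
def GrothGroup.restrict {B : Type w} [Ring B] (φ : A →+* B)
    (P : ModuleCat.{w} A → Prop) (Q : ModuleCat.{w} B → Prop)
    (h : ∀ M, Q M → P ((ModuleCat.restrictScalars φ).obj M)) : GrothGroup Q →+ GrothGroup P :=
  QuotientAddGroup.lift (AddSubgroup.closure (exactRelations Q))
    (FreeAbelianGroup.lift fun M => cls P _ (h M.1 M.2)) (by
      rw [AddSubgroup.closure_le]
      rintro x ⟨M', M, M'', f, g, hf, hfg, hg, rfl⟩
      have key := cls_exact (h _ M'.2) (h _ M.2) (h _ M''.2)
        ((ModuleCat.restrictScalars φ).map (ModuleCat.ofHom f)).hom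
        ((ModuleCat.restrictScalars φ).map (ModuleCat.ofHom g)).hom hf hfg hg
      simp [key])

theorem GrothGroup.restrict_cls {B : Type w} [Ring B] (φ : A →+* B)
    (P : ModuleCat.{w} A → Prop) (Q : ModuleCat.{w} B → Prop)
    (h : ∀ M, Q M → P ((ModuleCat.restrictScalars φ).obj M)) (M : ModuleCat.{w} B) (hM : Q M) :
    restrict φ P Q h (cls Q M hM) = cls P _ (h M hM) :=
  FreeAbelianGroup.lift_apply_of _ _

theorem GrothGroup.induction {P : ModuleCat.{w} A → Prop} {B : Type*} [AddCommGroup B]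
    {f g : GrothGroup P →+ B} (h : ∀ M hM, f (cls P M hM) = g (cls P M hM)) (x : GrothGroup P) :
    f x = g x := by
  obtain ⟨x, rfl⟩ := QuotientAddGroup.mk'_surjective (AddSubgroup.closure (exactRelations P)) x
  have : f.comp (QuotientAddGroup.mk' (AddSubgroup.closure (exactRelations P))) =
      g.comp (QuotientAddGroup.mk' (AddSubgroup.closure (exactRelations P))) :=
    FreeAbelianGroup.lift_ext _ _ fun M => h M.1 M.2
  exact DFunLike.congr_fun this x

/-- `K₀(A)`: the Grothendieck group of finitely generated projective left `A`-modules. -/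
abbrev K0 (A : Type w) [Ring A] : Type (w + 1) :=
  GrothGroup fun M : ModuleCat.{w} A => Module.Finite A M ∧ Module.Projective A M

/-- `G(A)`: the Grothendieck group of finitely generated left `A`-modules. -/
abbrev G (A : Type w) [Ring A] : Type (w + 1) :=
  GrothGroup fun M : ModuleCat.{w} A => Module.Finite A M

/-- `G^f(A)` for an `R`-algebra `A`: the Grothendieck group of the left `A`-modules that are
finitely generated over `R`. -/
abbrev Gf (R : Type v) (A : Type w) [CommRing R] [Ring A] [Algebra R A] : Type (w + 1) :=
  GrothGroup fun M : ModuleCat.{w} A =>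
    Module.Finite R ((ModuleCat.restrictScalars (algebraMap R A)).obj M)

end Grothendieck

section Restriction

variable (R : Type v) [CommRing R]

/-- A module that is finitely generated over `R` stays finitely generated after restriction of
scalars along a homomorphism of `R`-algebras. -/
theorem finite_restrict_of_finite_base {A B : Type w} [Ring A] [Ring B] [Algebra R A] [Algebra R B]
    (φ : A →ₐ[R] B) (M : ModuleCat.{w} B)
    (hM : Module.Finite R ((ModuleCat.restrictScalars (algebraMap R B)).obj M)) :
    Module.Finite A ((ModuleCat.restrictScalars (φ : A →+* B)).obj M) := by
  obtain ⟨s, hs⟩ := hM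
  refine ⟨s, ?_⟩
  rw [eq_top_iff]
  intro x _
  have hx : x ∈ Submodule.span R
      (s : Set ((ModuleCat.restrictScalars (algebraMap R B)).obj M)) := by
    rw [hs]; trivial
  induction hx using Submodule.span_induction with
  | mem x hx => exact Submodule.subset_span hx
  | zero => exact Submodule.zero_mem _
  | add x y _ _ h1 h2 => exact Submodule.add_mem _ (h1 trivial) (h2 trivial)
  | smul r x _ h1 =>
    have h2 := Submodule.smul_mem _ (algebraMap R A r) (h1 trivial)
    have h3 : (φ (algebraMap R A r) • (show M from x)) = (algebraMap R B r • (show M from x)) := by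
      rw [φ.commutes]
    exact h3 ▸ h2

/-- Over an algebra that is finite over `R`, finitely generated modules are finitely generated
over `R`. -/
theorem finite_base_of_finite {B : Type w} [Ring B] [Algebra R B] [Module.Finite R B]
    (M : ModuleCat.{w} B) (hM : Module.Finite B M) :
    Module.Finite R ((ModuleCat.restrictScalars (algebraMap R B)).obj M) := by
  let _ : Module R M := Module.compHom M (algebraMap R B)
  have : IsScalarTower R B M := ⟨fun r b m => by
    rw [Algebra.smul_def, mul_smul]; rfl⟩
  exact Module.Finite.trans (R := R) B M

/-- For `φ : H → H'` with `H'` finite, the map `G(R[H']) → G(R[H])` that lets `H` act through `φ`. -/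
def resG {H H' : Type u} [Group H] [Group H'] [Finite H'] (φ : H →* H') :
    G (MonoidAlgebra R H') →+ G (MonoidAlgebra R H) :=
  GrothGroup.restrict (MonoidAlgebra.mapDomainAlgHom R R φ : MonoidAlgebra R H →+* MonoidAlgebra R H')
    _ _ fun M hM => finite_restrict_of_finite_base R _ M (finite_base_of_finite R M hM)

/-- The restriction `res_H^Γ : G^f(R[Γ]) → G(R[H])`. -/
def resGf {Γ : Type u} [Group Γ] (H : Subgroup Γ) :
    Gf R (MonoidAlgebra R Γ) →+ G (MonoidAlgebra R H) :=
  GrothGroup.restrict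
    (MonoidAlgebra.mapDomainAlgHom R R H.subtype : MonoidAlgebra R H →+* MonoidAlgebra R Γ)
    _ _ fun M hM => finite_restrict_of_finite_base R _ M hM

/-- The conjugation isomorphism `C_γ : H → γHγ⁻¹`, `h ↦ γhγ⁻¹`. -/
abbrev conjHom {Γ : Type u} [Group Γ] (γ : Γ) (H : Subgroup Γ) :
    H →* H.map (MulAut.conj γ).toMonoidHom :=
  (MulAut.conj γ).toMonoidHom.subgroupMap H

/-- Restricting a `Γ`-module to `K` and then along `φ : H → K` gives the restriction to `H`, if `φ`
is conjugation by an element of `Γ`. -/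
theorem resG_resGf {Γ : Type u} [Group Γ] (H K : Subgroup Γ) [Finite K] (φ : H →* K) (γ : Γ)
    (hφ : ∀ h : H, (φ h : Γ) = γ * h * γ⁻¹) (x : Gf R (MonoidAlgebra R Γ)) :
    resG R φ (resGf R K x) = resGf R H x := by
  refine GrothGroup.induction (f := (resG R φ).comp (resGf R K)) (g := resGf R H) ?_ x
  intro M hM
  simp only [AddMonoidHom.comp_apply, resG, resGf, GrothGroup.restrict_cls]
  symm
  refine GrothGroup.cls_congr _ _ ?_ ?_
  · change Module.Finite (MonoidAlgebra R H) PUnit.{(max u v) + 1}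
    infer_instance
  · let M₀ : ModuleCat.{max u v} (MonoidAlgebra R Γ) := M
    have key : ∀ r : MonoidAlgebra R H, MonoidAlgebra.single γ (1 : R) *
        MonoidAlgebra.mapDomainAlgHom R R H.subtype r =
        MonoidAlgebra.mapDomainAlgHom R R K.subtype (MonoidAlgebra.mapDomainAlgHom R R φ r) *
          MonoidAlgebra.single γ (1 : R) := by
      intro r
      induction r using MonoidAlgebra.induction_linear with
      | zero => simp
      | add f g hf hg => simp only [map_add, mul_add, add_mul, hf, hg]
      | single h a => simp [MonoidAlgebra.single_mul_single, hφ]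
    let f : M → M := fun m => MonoidAlgebra.single γ (1 : R) • m
    let f' : M → M := fun m => MonoidAlgebra.single γ⁻¹ (1 : R) • m
    exact
      { toFun := f
        invFun := f'
        map_add' := fun a b => smul_add (MonoidAlgebra.single γ (1 : R)) (show M₀ from a) (show M₀ from b)
        map_smul' := fun r m => by
          change MonoidAlgebra.single γ (1 : R) •
              (MonoidAlgebra.mapDomainAlgHom R R H.subtype r • (show M₀ from m)) =
            MonoidAlgebra.mapDomainAlgHom R R K.subtype (MonoidAlgebra.mapDomainAlgHom R R φ r) •
              (MonoidAlgebra.single γ (1 : R) • (show M₀ from m))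
          rw [← mul_smul, ← mul_smul, key]
        left_inv := fun m => by
          change MonoidAlgebra.single γ⁻¹ (1 : R) • (MonoidAlgebra.single γ (1 : R) • (show M₀ from m)) = m
          rw [← mul_smul, MonoidAlgebra.single_mul_single, inv_mul_cancel, one_mul,
            ← MonoidAlgebra.one_def, one_smul]
        right_inv := fun m => by
          change MonoidAlgebra.single γ (1 : R) • (MonoidAlgebra.single γ⁻¹ (1 : R) • (show M₀ from m)) = m
          rw [← mul_smul, MonoidAlgebra.single_mul_single, mul_inv_cancel, one_mul,
            ← MonoidAlgebra.one_def, one_smul] }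

end Restriction

section Families

/-- A group is torsion-free if `1` is its only element of finite order. -/
def TorsionFree (Γ : Type u) [Group Γ] : Prop :=
  ∀ γ : Γ, IsOfFinOrder γ → γ = 1

/-- `Γ` is virtually torsion-free: it has a torsion-free subgroup of finite index. -/
def VirtuallyTorsionFree (Γ : Type u) [Group Γ] : Prop :=
  ∃ Γ' : Subgroup Γ, Γ'.FiniteIndex ∧ TorsionFree Γ'

/-- The finite conjugacy property: up to conjugacy `Γ` has only finitely many finite subgroups. -/
def FCP (Γ : Type u) [Group Γ] : Prop :=
  ∃ S : Set (Subgroup Γ), S.Finite ∧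
    ∀ H : Subgroup Γ, Finite H → ∃ K ∈ S, ∃ γ : Γ, H = K.map (MulAut.conj γ).toMonoidHom

/-- A family of finite subgroups of `Γ`: a non-empty collection of finite subgroups, closed under
conjugation and passage to subgroups. -/
structure FiniteFamily (Γ : Type u) [Group Γ] where
  carrier : Set (Subgroup Γ)
  nonempty : carrier.Nonempty
  finite : ∀ H ∈ carrier, Finite H
  conj_mem : ∀ (γ : Γ), ∀ H ∈ carrier, H.map (MulAut.conj γ).toMonoidHom ∈ carrier
  le_mem : ∀ H ∈ carrier, ∀ K : Subgroup Γ, K ≤ H → K ∈ carrier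

/-- The family of all finite subgroups. -/
def FiniteFamily.all (Γ : Type u) [Group Γ] : FiniteFamily Γ where
  carrier := {H | Finite H}
  nonempty := ⟨⊥, inferInstanceAs (Finite (⊥ : Subgroup Γ))⟩
  finite _ hH := hH
  conj_mem γ H hH := by
    have : Finite H := hH
    exact Finite.of_surjective _ ((MulAut.conj γ).toMonoidHom.subgroupMap_surjective H)
  le_mem H hH K hK := by
    have : Finite H := hH
    exact Finite.of_injective _ (Subgroup.inclusion_injective hK)

variable {Γ : Type u} [Group Γ] (R : Type v) [CommRing R] (F : FiniteFamily Γ)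

instance (H : F.carrier) : Finite H.1 := F.finite H.1 H.2

instance (γ : Γ) (H : F.carrier) : Finite (H.1.map (MulAut.conj γ).toMonoidHom) :=
  F.finite _ (F.conj_mem γ H.1 H.2)

/-- `γHγ⁻¹` as a member of the family. -/
abbrev FiniteFamily.conj (γ : Γ) (H : F.carrier) : F.carrier :=
  ⟨H.1.map (MulAut.conj γ).toMonoidHom, F.conj_mem γ H.1 H.2⟩

/-- `G_F(R[Γ]) = lim_{H ∈ F} G(R[H])`: the sequences `(x_H)` in `∏_{H ∈ F} G(R[H])` that are
compatible with restriction to subgroups and with conjugation. -/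
def GLim : AddSubgroup (∀ H : F.carrier, G (MonoidAlgebra R H.1)) where
  carrier := {x |
    (∀ (H K : F.carrier) (h : H.1 ≤ K.1), resG R (Subgroup.inclusion h) (x K) = x H) ∧
    (∀ (γ : Γ) (H : F.carrier), resG R (conjHom γ H.1) (x (F.conj γ H)) = x H)}
  zero_mem' := ⟨fun _ _ _ => map_zero _, fun _ _ => map_zero _⟩
  add_mem' {x y} hx hy :=
    ⟨fun H K h => by
      rw [Pi.add_apply, Pi.add_apply, map_add, hx.1 H K h, hy.1 H K h],
     fun γ H => by
      rw [Pi.add_apply, Pi.add_apply, map_add, hx.2 γ H, hy.2 γ H]⟩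
  neg_mem' {x} hx :=
    ⟨fun H K h => by rw [Pi.neg_apply, Pi.neg_apply, map_neg, hx.1 H K h],
     fun γ H => by rw [Pi.neg_apply, Pi.neg_apply, map_neg, hx.2 γ H]⟩

/-- The product `∏_{H ∈ F} res_H^Γ : G^f(R[Γ]) → ∏_{H ∈ F} G(R[H])` of the restrictions. -/
def resProd : Gf R (MonoidAlgebra R Γ) →+ ∀ H : F.carrier, G (MonoidAlgebra R H.1) :=
  AddMonoidHom.pi fun H => resGf R H.1

/-- The image of the product of the restrictions. -/
def GBar : AddSubgroup (∀ H : F.carrier, G (MonoidAlgebra R H.1)) :=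
  (resProd R F).range

theorem GBar_le_GLim : GBar R F ≤ GLim R F := by
  rintro _ ⟨x, rfl⟩
  exact ⟨fun H K h => resG_resGf R H.1 K.1 _ 1 (by simp) x,
    fun γ H => resG_resGf R H.1 (F.conj γ H).1 _ γ (fun h => rfl) x⟩

/-- The natural inclusion `j_F` of `GBar` into `G_F(R[Γ])`. -/
def j : GBar R F →+ GLim R F :=
  AddSubgroup.inclusion (GBar_le_GLim R F)

end Families

end DiscreteGroupK

end

/-! Everything rests on the pairing `([P], [M]) ↦ dim Hom(P, M)` between `K0` and `Gf` of the group
ring. It is additive in `P` because short exact sequences ending in a projective split. For `P =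
K[Γ]e` with `e` idempotent, `Hom(P, M)` is `eM`, whose dimension is additive in `M`. Hence, for an
idempotent `e` of `K[H]` with `H` finite, `dim eM` is both an invariant of the restriction of `M` to
`H` and the value at `[K[Γ]e]` of a functional on `K0` (`exists_functional`, `rkG_resGf`).

Rank inequality: `K[H]` is semisimple by Maschke, so an element of `G(K[H])` is determined by its
values under `dim e(-)` for finitely many `e` generating the simple modules
(`eq_zero_of_rkG_eq_zero`). Elements of the limit are compatible with conjugation, so by FCP
finitely many `H` suffice. The image of `j` thus embeds in `ℤ^T` with `T` finite, every coordinate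
being the value of a functional at a fixed class of `K0`. Functionals separate no more dimensions
than these classes span (`rank_le_of_functionals`).

Torsion: let `e` average the powers of a torsion element `γ`. The trivial module pairs to the same
nonzero value with `[K[Γ]e]` and `[K[Γ]]`, so the two classes agree when `K0 ≅ ℤ`. Pairing with
`K[Q]`, for `Q` the quotient by the normal core of a torsion-free subgroup of finite index, forces
`e ↦ 1` in `K[Q]`. As `γe = e`, `γ` lies in that core, so `γ = 1`. -/

namespace DiscreteGroupK

/-! ### Additive invariants and elements of Grothendieck groups -/

section GrothendieckLift

variable {A : Type w} [Ring A]

/-- An additive invariant of modules factors through the Grothendieck group. -/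
noncomputable def GrothGroup.lift {B : Type*} [AddCommGroup B] (P : ModuleCat.{w} A → Prop)
    (φ : ModuleCat.{w} A → B)
    (hφ : ∀ (M' M M'' : ModuleCat.{w} A), P M' → P M → P M'' →
      ∀ (f : M' →ₗ[A] M) (g : M →ₗ[A] M''), Function.Injective f → Function.Exact f g →
        Function.Surjective g → φ M = φ M' + φ M'') :
    GrothGroup P →+ B :=
  QuotientAddGroup.lift (AddSubgroup.closure (exactRelations P))
    (FreeAbelianGroup.lift fun M => φ M.1) (by
      rw [AddSubgroup.closure_le]
      rintro x ⟨M', M, M'', f, g, hf, hfg, hg, rfl⟩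
      simp [hφ _ _ _ M'.2 M.2 M''.2 f g hf hfg hg])

theorem GrothGroup.lift_cls {B : Type*} [AddCommGroup B] (P : ModuleCat.{w} A → Prop)
    (φ : ModuleCat.{w} A → B) (hφ) (M : ModuleCat.{w} A) (hM : P M) :
    GrothGroup.lift P φ hφ (GrothGroup.cls P M hM) = φ M :=
  FreeAbelianGroup.lift_apply_of _ _

theorem GrothGroup.induction_on {P : ModuleCat.{w} A → Prop} {p : GrothGroup P → Prop}
    (h0 : p 0) (hcls : ∀ M hM, p (cls P M hM)) (hneg : ∀ x, p x → p (-x))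
    (hadd : ∀ x y, p x → p y → p (x + y)) (x : GrothGroup P) : p x := by
  obtain ⟨x, rfl⟩ := QuotientAddGroup.mk'_surjective (AddSubgroup.closure (exactRelations P)) x
  induction x using FreeAbelianGroup.induction_on with
  | zero => rw [map_zero]; exact h0
  | of M => exact hcls M.1 M.2
  | neg M _ => rw [map_neg]; exact hneg _ (hcls M.1 M.2)
  | add x y hx hy => rw [map_add]; exact hadd _ _ hx hy

/-- Every element of `G(A)` is a difference of two classes. -/
theorem G.exists_cls_sub_cls (x : G A) : ∃ (M N : ModuleCat.{w} A) (hM : Module.Finite A M)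
    (hN : Module.Finite A N), x = GrothGroup.cls _ M hM - GrothGroup.cls _ N hN := by
  -- Direct sums realise sums of classes, so a sum of two differences is again a difference.
  have hprod (M N : ModuleCat.{w} A) (hM : Module.Finite A M) (hN : Module.Finite A N) :
      ∃ h : Module.Finite A (ModuleCat.of A (M × N)),
        GrothGroup.cls (fun M : ModuleCat.{w} A => Module.Finite A M) _ h =
          GrothGroup.cls _ M hM + GrothGroup.cls _ N hN := by
    refine ⟨inferInstanceAs (Module.Finite A (M × N)), ?_⟩
    exact GrothGroup.cls_exact (M := ModuleCat.of A (M × N)) hM _ hN (LinearMap.inl A M N)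
      (LinearMap.snd A M N)
      LinearMap.inl_injective Function.Exact.inl_snd LinearMap.snd_surjective
  have h0 : Module.Finite A (ModuleCat.of A PUnit.{w + 1}) :=
    inferInstanceAs (Module.Finite A PUnit.{w + 1})
  have hz : GrothGroup.cls (fun M : ModuleCat.{w} A => Module.Finite A M) _ h0 = 0 := by
    have h := GrothGroup.cls_exact (P := fun M : ModuleCat.{w} A => Module.Finite A M) h0 h0 h0
      (0 : ModuleCat.of A PUnit.{w + 1} →ₗ[A] _) 0
      (fun a b _ => Subsingleton.elim (α := PUnit) a b)
      (fun a => ⟨fun _ => ⟨0, rfl⟩, fun _ => rfl⟩)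
      (fun a => ⟨0, rfl⟩)
    simpa using h
  induction x using GrothGroup.induction_on with
  | h0 => exact ⟨_, _, h0, h0, by simp⟩
  | hcls M hM => exact ⟨M, _, hM, h0, by simp [hz]⟩
  | hneg x hx =>
    obtain ⟨M, N, hM, hN, rfl⟩ := hx
    exact ⟨N, M, hN, hM, by abel⟩
  | hadd x y hx hy =>
    obtain ⟨M, N, hM, hN, rfl⟩ := hx
    obtain ⟨M', N', hM', hN', rfl⟩ := hy
    obtain ⟨h1, h1'⟩ := hprod M M' hM hM'
    obtain ⟨h2, h2'⟩ := hprod N N' hN hN'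
    exact ⟨_, _, h1, h2, by rw [h1', h2']; abel⟩

end GrothendieckLift

/-! ### Dimensions of `eM` and of `Hom(P, M)` -/

section Invariants

variable (K : Type v) [Field K] {A : Type w} [Ring A] [Algebra K A]

/-- The elements of an `A`-module that are fixed by `e`. For `e` idempotent this is `eM`. -/
def fixedSub (M : Type*) [AddCommGroup M] [Module A M] [Module K M] [IsScalarTower K A M] (e : A) :
    Submodule K M where
  carrier := {m | e • m = m}
  add_mem' {a b} ha hb := by
    simp only [Set.mem_ofPred_eq] at ha hb ⊢
    rw [smul_add, ha, hb]
  zero_mem' := smul_zero e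
  smul_mem' k m hm := by
    simp only [Set.mem_ofPred_eq] at hm ⊢
    rw [← algebraMap_smul A k m, ← mul_smul, ← Algebra.commutes, mul_smul, hm]

theorem mem_fixedSub {M : Type*} [AddCommGroup M] [Module A M] [Module K M] [IsScalarTower K A M]
    {e : A} {m : M} : m ∈ fixedSub K M e ↔ e • m = m := Iff.rfl

/-- The functor `M ↦ eM` is exact: any preimage `x` of an element of `eM''` can be replaced by `e •
x`, which is fixed because `e` is idempotent. -/
theorem finrank_fixedSub_of_exact {M' M M'' : Type*} [AddCommGroup M'] [AddCommGroup M]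
    [AddCommGroup M''] [Module A M'] [Module A M] [Module A M''] [Module K M'] [Module K M]
    [Module K M''] [IsScalarTower K A M'] [IsScalarTower K A M] [IsScalarTower K A M'']
    [Module.Finite K M] {e : A} (he : IsIdempotentElem e) (f : M' →ₗ[A] M) (g : M →ₗ[A] M'')
    (hf : Function.Injective f) (hfg : Function.Exact f g) (hg : Function.Surjective g) :
    Module.finrank K (fixedSub K M e) =
      Module.finrank K (fixedSub K M' e) + Module.finrank K (fixedSub K M'' e) := by
  let f' : fixedSub K M' e →ₗ[K] fixedSub K M e := (f.restrictScalars K).restrict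
    (fun m hm => by
      rw [mem_fixedSub] at hm ⊢
      rw [LinearMap.restrictScalars_apply, ← map_smul, hm])
  let g' : fixedSub K M e →ₗ[K] fixedSub K M'' e := (g.restrictScalars K).restrict
    (fun m hm => by
      rw [mem_fixedSub] at hm ⊢
      rw [LinearMap.restrictScalars_apply, ← map_smul, hm])
  have hf' : Function.Injective f' := fun a b h => Subtype.ext (hf (congrArg Subtype.val h))
  have hg' : LinearMap.range g' = ⊤ := by
    rw [LinearMap.range_eq_top]
    rintro ⟨m, hm⟩
    obtain ⟨x, rfl⟩ := hg m
    refine ⟨⟨e • x, ?_⟩, Subtype.ext ?_⟩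
    · rw [mem_fixedSub, ← mul_smul, he.eq]
    · change g (e • x) = g x
      rw [map_smul]
      exact hm
  have hker : LinearMap.ker g' = LinearMap.range f' := by
    ext ⟨m, hm⟩
    rw [LinearMap.mem_ker, LinearMap.mem_range]
    constructor
    · intro h
      obtain ⟨x, hx⟩ := (hfg m).1 (congrArg Subtype.val h)
      refine ⟨⟨x, hf ?_⟩, Subtype.ext hx⟩
      rw [map_smul, hx]
      exact hm
    · rintro ⟨x, hx⟩
      exact Subtype.ext ((hfg m).2 ⟨x, congrArg Subtype.val hx⟩)
  have h := LinearMap.finrank_range_add_finrank_ker g'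
  rw [hg', finrank_top, hker, LinearMap.finrank_range_of_inj hf'] at h
  rw [← h, add_comm]

/-- A homomorphism out of `Ae` is determined by the image of `e`, which can be any element
fixed by `e`. -/
noncomputable def homSpanIdempotentEquiv (M : Type*) [AddCommGroup M] [Module A M] [Module K M]
    [IsScalarTower K A M] {e : A} (he : IsIdempotentElem e) :
    ((Submodule.span A {e} : Submodule A A) →ₗ[A] M) ≃ₗ[K] fixedSub K M e where
  toFun f := ⟨f ⟨e, Submodule.mem_span_singleton_self e⟩, by
    rw [mem_fixedSub, ← map_smul]
    congr 1
    exact Subtype.ext he.eq⟩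
  map_add' _ _ := rfl
  map_smul' _ _ := rfl
  invFun m := (LinearMap.toSpanSingleton A M m.1).domRestrict _
  left_inv f := by
    ext ⟨a, ha⟩
    obtain ⟨b, rfl⟩ := Submodule.mem_span_singleton.1 ha
    change (b • e) • f _ = _
    rw [← map_smul]
    congr 1
    exact Subtype.ext (by simp [mul_assoc, he.eq])
  right_inv m := Subtype.ext m.2

/-- Right multiplication by `e` retracts `A` onto `Ae`. -/
theorem projective_span_idempotent {e : A} (he : IsIdempotentElem e) :
    Module.Projective A (Submodule.span A {e} : Submodule A A) :=
  Module.Projective.of_split (Submodule.subtype _)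
    ((LinearMap.toSpanSingleton A A e).codRestrict _
      (fun a => Submodule.smul_mem _ a (Submodule.mem_span_singleton_self e)))
    (by
      ext ⟨a, ha⟩
      obtain ⟨b, rfl⟩ := Submodule.mem_span_singleton.1 ha
      change (b * e) * e = b * e
      rw [mul_assoc, he.eq])

/-- A surjection `A^n → P` embeds `Hom(P, M)` in `M^n`. -/
theorem finite_hom_of_finite (P M : Type*) [AddCommGroup P] [AddCommGroup M] [Module A P]
    [Module A M] [Module K M] [IsScalarTower K A M] [Module.Finite A P] [Module.Finite K M] :
    Module.Finite K (P →ₗ[A] M) := by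
  obtain ⟨n, π, hπ⟩ := Module.Finite.exists_fin' A P
  let φ : (P →ₗ[A] M) →ₗ[K] (Fin n → M) :=
    { toFun := fun f i => f (π (Pi.single i 1))
      map_add' := fun _ _ => rfl
      map_smul' := fun _ _ => rfl }
  refine Module.Finite.of_injective φ fun f g h => ?_
  have h2 : f.comp π = g.comp π := by
    refine LinearMap.pi_ext' fun i => LinearMap.ext_ring ?_
    exact congrFun h i
  exact LinearMap.ext fun x => by
    obtain ⟨y, rfl⟩ := hπ x
    exact LinearMap.congr_fun h2 y

/-- Projectivity of `P''` splits the sequence, so `Hom(-, M)` keeps it exact. -/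
theorem finrank_hom_of_exact {P' P P'' M : Type*} [AddCommGroup P'] [AddCommGroup P]
    [AddCommGroup P''] [Module A P'] [Module A P] [Module A P''] [AddCommGroup M] [Module A M]
    [Module K M] [IsScalarTower K A M] [Module.Finite A P] [Module.Finite K M]
    [Module.Projective A P''] (f : P' →ₗ[A] P) (g : P →ₗ[A] P'')
    (hf : Function.Injective f) (hfg : Function.Exact f g) (hg : Function.Surjective g) :
    Module.finrank K (P →ₗ[A] M) =
      Module.finrank K (P' →ₗ[A] M) + Module.finrank K (P'' →ₗ[A] M) := by
  have := finite_hom_of_finite K (A := A) P M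
  obtain ⟨s, hs⟩ := Module.projective_lifting_property g LinearMap.id hg
  have hgs (x : P'') : g (s x) = x := LinearMap.congr_fun hs x
  -- Subtracting the part seen by the section `s` lands in the image of `f`; this gives the
  -- retraction `rl` of `P` onto `P'`.
  have hr : ∀ x : P, ∃ y : P', f y = x - s (g x) := fun x =>
    (hfg _).1 (by rw [map_sub, hgs, sub_self])
  choose r hr using hr
  let rl : P →ₗ[A] P' :=
    { toFun := r
      map_add' := fun x y => hf (by rw [map_add, hr, hr, hr, map_add, map_add]; abel)
      map_smul' := fun a x => hf (by
        rw [RingHom.id_apply, map_smul, hr, hr, map_smul, map_smul, smul_sub]) }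
  have hrf (x : P') : rl (f x) = x := hf (by
    change f (r (f x)) = f x
    rw [hr, (hfg _).2 ⟨x, rfl⟩, map_zero, sub_zero])
  let f' : (P →ₗ[A] M) →ₗ[K] (P' →ₗ[A] M) :=
    { toFun := fun φ => φ.comp f, map_add' := fun _ _ => rfl, map_smul' := fun _ _ => rfl }
  let g' : (P'' →ₗ[A] M) →ₗ[K] (P →ₗ[A] M) :=
    { toFun := fun φ => φ.comp g, map_add' := fun _ _ => rfl, map_smul' := fun _ _ => rfl }
  have hg' : Function.Injective g' := fun φ ψ h => LinearMap.ext fun x => by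
    obtain ⟨y, rfl⟩ := hg x
    exact LinearMap.congr_fun h y
  have hf' : LinearMap.range f' = ⊤ := by
    rw [LinearMap.range_eq_top]
    intro φ
    exact ⟨φ.comp rl, LinearMap.ext fun x => congrArg φ (hrf x)⟩
  have hker : LinearMap.ker f' = LinearMap.range g' := by
    ext φ
    rw [LinearMap.mem_ker, LinearMap.mem_range]
    constructor
    · intro h
      refine ⟨φ.comp s, LinearMap.ext fun x => ?_⟩
      change φ (s (g x)) = φ x
      have h1 : φ (f (r x)) = 0 := LinearMap.congr_fun h (r x)
      rw [hr, map_sub, sub_eq_zero] at h1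
      exact h1.symm
    · rintro ⟨ψ, rfl⟩
      refine LinearMap.ext fun x => ?_
      change ψ (g (f x)) = 0
      rw [(hfg _).2 ⟨x, rfl⟩, map_zero]
  have h := LinearMap.finrank_range_add_finrank_ker f'
  rw [hf', finrank_top, hker, LinearMap.finrank_range_of_inj hg'] at h
  exact h.symm

end Invariants

/-! ### The pairing between `K0` and `Gf` -/

section Bundled

variable (K : Type v) [Field K] {A : Type w} [Ring A] [Algebra K A]

/-- The underlying vector space of a module over a `K`-algebra. -/
abbrev baseModule (M : ModuleCat.{w} A) : Module K M := Module.compHom M (algebraMap K A)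

theorem baseModule_isScalarTower (M : ModuleCat.{w} A) :
    letI := baseModule K M; IsScalarTower K A M :=
  letI := baseModule K M
  ⟨fun k a m => by rw [Algebra.smul_def, mul_smul]; rfl⟩

/-- The dimension of `eM` for a module `M` over a `K`-algebra. -/
noncomputable def rk (e : A) (M : ModuleCat.{w} A) : ℕ :=
  letI := baseModule K M
  haveI := baseModule_isScalarTower K M
  Module.finrank K (fixedSub K M e)

/-- The dimension of `Hom_A(P, M)` for modules over a `K`-algebra `A`. -/
noncomputable def hdim (P M : ModuleCat.{w} A) : ℕ :=
  letI := baseModule K M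
  haveI := baseModule_isScalarTower K M
  Module.finrank K (P →ₗ[A] M)

/-- `[M] ↦ dim eM` on the Grothendieck group of modules finite-dimensional over `K`. -/
noncomputable def rkHom (P : ModuleCat.{w} A → Prop)
    (hP : ∀ M, P M → Module.Finite K ((ModuleCat.restrictScalars (algebraMap K A)).obj M))
    {e : A} (he : IsIdempotentElem e) : GrothGroup P →+ ℤ :=
  GrothGroup.lift P (fun M => (rk K e M : ℤ)) (by
    intro M' M M'' _ hM _ f g hf hfg hg
    let _ := baseModule K M'
    let _ := baseModule K M
    let _ := baseModule K M''
    have := baseModule_isScalarTower K M'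
    have := baseModule_isScalarTower K M
    have := baseModule_isScalarTower K M''
    have : Module.Finite K M := hP M hM
    exact_mod_cast finrank_fixedSub_of_exact K he f g hf hfg hg)

/-- `[P] ↦ dim Hom_A(P, M)` on `K₀(A)`. -/
noncomputable def homDim (M : ModuleCat.{w} A)
    (hM : Module.Finite K ((ModuleCat.restrictScalars (algebraMap K A)).obj M)) : K0 A →+ ℤ :=
  GrothGroup.lift _ (fun P => (hdim K P M : ℤ)) (by
    intro P' P P'' hP' hP hP'' f g hf hfg hg
    let _ := baseModule K M
    have := baseModule_isScalarTower K M
    have : Module.Finite K M := hM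
    have := hP.1
    have := hP''.2
    exact_mod_cast finrank_hom_of_exact K (M := M) f g hf hfg hg)

/-- The class of `Ae` in `K₀(A)`. -/
noncomputable def idemCls {e : A} (he : IsIdempotentElem e) : K0 A :=
  GrothGroup.cls _ (ModuleCat.of A (Submodule.span A {e} : Submodule A A))
    ⟨inferInstanceAs (Module.Finite A (Submodule.span A {e} : Submodule A A)),
      projective_span_idempotent he⟩

theorem homDim_idemCls (M : ModuleCat.{w} A)
    (hM : Module.Finite K ((ModuleCat.restrictScalars (algebraMap K A)).obj M))
    {e : A} (he : IsIdempotentElem e) : homDim K M hM (idemCls he) = rk K e M := by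
  let _ := baseModule K M
  have := baseModule_isScalarTower K M
  rw [homDim, idemCls, GrothGroup.lift_cls]
  exact_mod_cast (homSpanIdempotentEquiv K M he).finrank_eq

/-- Each element of `G^f(A)` defines a functional on `K₀(A)` that sends `[Ae]` to the virtual
dimension of the image of `e`. -/
theorem exists_functional (x : Gf K A) : ∃ f : K0 A →+ ℤ,
    ∀ (e : A) (he : IsIdempotentElem e), f (idemCls he) = rkHom K _ (fun _ h => h) he x := by
  induction x using GrothGroup.induction_on with
  | h0 => exact ⟨0, by simp⟩
  | hcls M hM => exact ⟨homDim K M hM, fun e he => by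
      rw [homDim_idemCls, rkHom, GrothGroup.lift_cls]⟩
  | hneg x hx =>
    obtain ⟨f, hf⟩ := hx
    exact ⟨-f, fun e he => by rw [AddMonoidHom.neg_apply, hf, map_neg]⟩
  | hadd x y hx hy =>
    obtain ⟨f, hf⟩ := hx
    obtain ⟨g, hg⟩ := hy
    exact ⟨f + g, fun e he => by rw [AddMonoidHom.add_apply, hf, hg, map_add]⟩

/-- Both sides are the dimension of the same set: `e` acts on the restricted module as `φ e`. -/
theorem rk_restrictScalars {B : Type w} [Ring B] [Algebra K B] (φ : A →ₐ[K] B)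
    (M : ModuleCat.{w} B) (e : A) :
    rk K e ((ModuleCat.restrictScalars (φ : A →+* B)).obj M) = rk K (φ e) M := by
  let _ := baseModule K M
  have := baseModule_isScalarTower K M
  let _ := baseModule K ((ModuleCat.restrictScalars (φ : A →+* B)).obj M)
  have := baseModule_isScalarTower K ((ModuleCat.restrictScalars (φ : A →+* B)).obj M)
  let i : fixedSub K ((ModuleCat.restrictScalars (φ : A →+* B)).obj M) e ≃ₗ[K]
      fixedSub K M (φ e) :=
    { toFun := fun m => ⟨m.1, m.2⟩
      invFun := fun m => ⟨m.1, m.2⟩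
      map_add' := fun _ _ => rfl
      map_smul' := fun k m => Subtype.ext (by
        change φ (algebraMap K A k) • (show M from m.1) = algebraMap K B k • (show M from m.1)
        rw [φ.commutes])
      left_inv := fun _ => rfl
      right_inv := fun _ => rfl }
  exact i.finrank_eq

end Bundled


/-! ### Semisimple algebras: classes are determined by multiplicities -/

section Semisimple

/-- Over a semisimple ring there are, up to isomorphism, finitely many simple modules, and each
is generated by an idempotent. -/
theorem exists_finite_idempotents (A : Type w) [Ring A] [IsSemisimpleRing A] :
    ∃ E : Set A, E.Finite ∧ (∀ e ∈ E, IsIdempotentElem e ∧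
        IsSimpleModule A (Submodule.span A {e} : Submodule A A)) ∧
      ∀ (S : Type w) [AddCommGroup S] [Module A S] [IsSimpleModule A S],
        ∃ e ∈ E, Nonempty ((Submodule.span A {e} : Submodule A A) ≃ₗ[A] S) := by
  have key : ∀ c : isotypicComponents A A, ∃ e : A, IsIdempotentElem e ∧
      IsSimpleModule A (Submodule.span A {e} : Submodule A A) ∧
      c.1 = isotypicComponent A A (Submodule.span A {e} : Submodule A A) := by
    rintro ⟨c, S, hS, hc⟩
    obtain ⟨e, he, hSe⟩ := IsSemisimpleRing.ideal_eq_span_idempotent S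
    have hSe : S = (Submodule.span A {e} : Submodule A A) := hSe
    subst hSe
    exact ⟨e, he, hS, hc⟩
  choose e he hs hc using key
  -- One idempotent is chosen per isotypic component, and a semisimple ring has finitely many of
  -- these.
  refine ⟨Set.range e, Set.finite_range e, ?_, ?_⟩
  · rintro _ ⟨c, rfl⟩
    exact ⟨he c, hs c⟩
  · intro S _ _ _
    obtain ⟨I, ⟨i⟩⟩ := IsSemisimpleRing.exists_linearEquiv_ideal_of_isSimpleModule A S
    have hI : IsSimpleModule A I := IsSimpleModule.congr i.symm
    let c : isotypicComponents A A := ⟨isotypicComponent A A I, I, hI, rfl⟩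
    have := hs c
    have h1 : IsIsotypicOfType A c.1 (Submodule.span A {e c} : Submodule A A) := by
      rw [hc c]
      exact IsIsotypicOfType.isotypicComponent A A _
    obtain ⟨i'⟩ := isIsotypicOfType_submodule_iff.1 h1 I I.le_isotypicComponent
    exact ⟨e c, ⟨c, rfl⟩, ⟨i'.symm.trans i.symm⟩⟩

theorem generator_ne_zero {A : Type w} [Ring A] (e : A)
    [IsSimpleModule A (Submodule.span A {e} : Submodule A A)] : e ≠ 0 := by
  rintro rfl
  have := IsSimpleModule.nontrivial A (Submodule.span A {(0 : A)} : Submodule A A)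
  rw [Submodule.span_zero_singleton] at this
  exact not_subsingleton (⊥ : Submodule A A) inferInstance

variable (K : Type v) [Field K] {A : Type w} [Ring A] [Algebra K A]

theorem rk_ne_zero_iff (M : ModuleCat.{w} A)
    (hM : Module.Finite K ((ModuleCat.restrictScalars (algebraMap K A)).obj M)) (e : A) :
    rk K e M ≠ 0 ↔ ∃ m : M, m ≠ 0 ∧ e • m = m := by
  let _ := baseModule K M
  have := baseModule_isScalarTower K M
  have : Module.Finite K M := hM
  change Module.finrank K (fixedSub K M e) ≠ 0 ↔ _
  rw [Ne, Submodule.finrank_eq_zero, ← Ne, Submodule.ne_bot_iff]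
  exact ⟨fun ⟨m, h, h'⟩ => ⟨m, h', h⟩, fun ⟨m, h, h'⟩ => ⟨m, h', h⟩⟩

/-- If `Ae` is simple and `eM ≠ 0` then `M` contains a copy of `Ae`. -/
theorem exists_injective_of_rk_ne_zero (M : ModuleCat.{w} A)
    (hM : Module.Finite K ((ModuleCat.restrictScalars (algebraMap K A)).obj M)) {e : A}
    [IsSimpleModule A (Submodule.span A {e} : Submodule A A)]
    (h : rk K e M ≠ 0) :
    ∃ f : (Submodule.span A {e} : Submodule A A) →ₗ[A] M, Function.Injective f := by
  obtain ⟨m, hm, hem⟩ := (rk_ne_zero_iff K M hM e).1 h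
  refine ⟨(LinearMap.toSpanSingleton A M m).domRestrict _, LinearMap.injective_of_ne_zero ?_⟩
  intro h0
  have h1 := LinearMap.congr_fun h0 ⟨e, Submodule.mem_span_singleton_self e⟩
  exact hm (hem.symm.trans h1)

theorem rk_ne_zero_of_injective (M : ModuleCat.{w} A)
    (hM : Module.Finite K ((ModuleCat.restrictScalars (algebraMap K A)).obj M)) {e : A}
    (he : IsIdempotentElem e) [IsSimpleModule A (Submodule.span A {e} : Submodule A A)]
    (f : (Submodule.span A {e} : Submodule A A) →ₗ[A] M) (hf : Function.Injective f) :
    rk K e M ≠ 0 := by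
  rw [rk_ne_zero_iff K M hM e]
  refine ⟨f ⟨e, Submodule.mem_span_singleton_self e⟩, ?_, ?_⟩
  · intro h0
    have h1 : (⟨e, Submodule.mem_span_singleton_self e⟩ :
        (Submodule.span A {e} : Submodule A A)) = 0 := hf (h0.trans (map_zero f).symm)
    have h2 : e = 0 := congrArg Subtype.val h1
    exact generator_ne_zero e h2
  · rw [← map_smul]
    exact congrArg f (Subtype.ext he.eq)

variable [Module.Finite K A]

/-- `[M] ↦ dim eM` on `G(A)` for a finite-dimensional algebra `A`. -/
noncomputable def rkG {e : A} (he : IsIdempotentElem e) : G A →+ ℤ :=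
  rkHom K _ (fun M hM => finite_base_of_finite K M hM) he

theorem rkG_cls {e : A} (he : IsIdempotentElem e) (M : ModuleCat.{w} A) (hM : Module.Finite A M) :
    rkG K he (GrothGroup.cls _ M hM) = rk K e M := by
  rw [rkG, rkHom, GrothGroup.lift_cls]

variable [IsSemisimpleRing A]

/-- Finitely generated modules over a semisimple algebra are determined in `G(A)` by their
multiplicities of simple modules. -/
theorem cls_eq_of_rk_eq {E : Set A}
    (hE : ∀ e ∈ E, IsIdempotentElem e ∧ IsSimpleModule A (Submodule.span A {e} : Submodule A A))
    (hE' : ∀ (S : Type w) [AddCommGroup S] [Module A S] [IsSimpleModule A S],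
        ∃ e ∈ E, Nonempty ((Submodule.span A {e} : Submodule A A) ≃ₗ[A] S))
    (M N : ModuleCat.{w} A) (hM : Module.Finite A M) (hN : Module.Finite A N)
    (h : ∀ e ∈ E, rk K e M = rk K e N) :
    GrothGroup.cls (fun M : ModuleCat.{w} A => Module.Finite A M) M hM =
      GrothGroup.cls _ N hN := by
  -- A nonzero `M` contains some simple `Ae`; then `eM ≠ 0`, so `eN ≠ 0` and `N` contains `Ae` too.
  have common (M N : ModuleCat.{w} A) (hM : Module.Finite A M) (hN : Module.Finite A N)
      (h : ∀ e ∈ E, rk K e M = rk K e N) (hM0 : Nontrivial M) :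
      ∃ e ∈ E, (∃ f : (Submodule.span A {e} : Submodule A A) →ₗ[A] M, Function.Injective f) ∧
        ∃ f : (Submodule.span A {e} : Submodule A A) →ₗ[A] N, Function.Injective f := by
    obtain ⟨S, hS⟩ := IsSemisimpleModule.exists_simple_submodule A M
    obtain ⟨e, he, ⟨i⟩⟩ := hE' S
    have := (hE e he).2
    have hf : Function.Injective (S.subtype.comp i.toLinearMap) :=
      S.injective_subtype.comp i.injective
    refine ⟨e, he, ⟨_, hf⟩, exists_injective_of_rk_ne_zero K N (finite_base_of_finite K N hN) ?_⟩
    rw [← h e he]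
    exact rk_ne_zero_of_injective K M (finite_base_of_finite K M hM) (hE e he).1 _ hf
  -- `rk K 1 M` is `dim M`. A common simple submodule is split off both modules until both are zero.
  induction hn : rk K 1 M using Nat.strong_induction_on generalizing M N with
  | _ n ih =>
    by_cases h0 : Subsingleton M ∧ Subsingleton N
    · obtain ⟨_, _⟩ := h0
      exact GrothGroup.cls_congr hM hN (inferInstanceAs (Module.Finite A PUnit.{w + 1}))
        { (0 : M →ₗ[A] N) with
          invFun := 0
          left_inv := fun _ => Subsingleton.elim _ _
          right_inv := fun _ => Subsingleton.elim _ _ }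
    obtain ⟨e, he, ⟨f, hf⟩, ⟨g, hg⟩⟩ :
        ∃ e ∈ E, (∃ f : (Submodule.span A {e} : Submodule A A) →ₗ[A] M, Function.Injective f) ∧
          ∃ f : (Submodule.span A {e} : Submodule A A) →ₗ[A] N, Function.Injective f := by
      -- The hypothesis is symmetric, so it is enough that one of the two modules is nonzero.
      by_cases hM0 : Subsingleton M
      · have hN0 : Nontrivial N := not_subsingleton_iff_nontrivial.1 fun h1 => h0 ⟨hM0, h1⟩
        obtain ⟨e, he, h1, h2⟩ := common N M hN hM (fun e he => (h e he).symm) hN0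
        exact ⟨e, he, h2, h1⟩
      · exact common M N hM hN h (not_subsingleton_iff_nontrivial.1 hM0)
    have hsimple := (hE e he).2
    let S : ModuleCat.{w} A := ModuleCat.of A (Submodule.span A {e} : Submodule A A)
    have hS : Module.Finite A S :=
      inferInstanceAs (Module.Finite A (Submodule.span A {e} : Submodule A A))
    let M₁ : ModuleCat.{w} A := ModuleCat.of A (M ⧸ LinearMap.range f)
    let N₁ : ModuleCat.{w} A := ModuleCat.of A (N ⧸ LinearMap.range g)
    have hM₁ : Module.Finite A M₁ := inferInstanceAs (Module.Finite A (M ⧸ LinearMap.range f))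
    have hN₁ : Module.Finite A N₁ := inferInstanceAs (Module.Finite A (N ⧸ LinearMap.range g))
    have hclsM := GrothGroup.cls_exact (P := fun M : ModuleCat.{w} A => Module.Finite A M)
      (M' := S) (M'' := M₁) hS hM hM₁ f (LinearMap.range f).mkQ hf
      (LinearMap.exact_map_mkQ_range f) (Submodule.mkQ_surjective _)
    have hclsN := GrothGroup.cls_exact (P := fun M : ModuleCat.{w} A => Module.Finite A M)
      (M' := S) (M'' := N₁) hS hN hN₁ g (LinearMap.range g).mkQ hg
      (LinearMap.exact_map_mkQ_range g) (Submodule.mkQ_surjective _)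
    have hrkM {x : A} (hx : IsIdempotentElem x) : rk K x M = rk K x S + rk K x M₁ := by
      have := congrArg (rkG K hx) hclsM
      rw [map_add, rkG_cls, rkG_cls, rkG_cls] at this
      exact_mod_cast this
    have hrkN {x : A} (hx : IsIdempotentElem x) : rk K x N = rk K x S + rk K x N₁ := by
      have := congrArg (rkG K hx) hclsN
      rw [map_add, rkG_cls, rkG_cls, rkG_cls] at this
      exact_mod_cast this
    have hpos : rk K 1 S ≠ 0 := by
      rw [rk_ne_zero_iff K S (finite_base_of_finite K S hS)]
      refine ⟨⟨e, Submodule.mem_span_singleton_self e⟩, fun h0 => ?_, one_smul _ _⟩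
      exact generator_ne_zero e (congrArg Subtype.val h0)
    have h1 := hrkM (IsIdempotentElem.one (M := A))
    rw [hclsM, hclsN, ih (rk K 1 M₁) (by omega) M₁ N₁ hM₁ hN₁ (fun x hx => ?_) rfl]
    have := h x hx
    rw [hrkM (hE x hx).1, hrkN (hE x hx).1] at this
    exact Nat.add_left_cancel this

/-- An element of `G(A)` with vanishing multiplicities is zero. -/
theorem eq_zero_of_rkG_eq_zero {E : Set A}
    (hE : ∀ e ∈ E, IsIdempotentElem e ∧ IsSimpleModule A (Submodule.span A {e} : Submodule A A))
    (hE' : ∀ (S : Type w) [AddCommGroup S] [Module A S] [IsSimpleModule A S],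
        ∃ e ∈ E, Nonempty ((Submodule.span A {e} : Submodule A A) ≃ₗ[A] S))
    (x : G A) (hx : ∀ e (he : e ∈ E), rkG K (hE e he).1 x = 0) : x = 0 := by
  obtain ⟨M, N, hM, hN, rfl⟩ := G.exists_cls_sub_cls x
  rw [sub_eq_zero]
  refine cls_eq_of_rk_eq K hE hE' M N hM hN fun e he => ?_
  have := hx e he
  rw [map_sub, rkG_cls, rkG_cls, sub_eq_zero] at this
  exact_mod_cast this

end Semisimple

/-! ### A rank bound from functionals -/

section LinearAlgebra

open scoped TensorProduct

/-- If `L` embeds in `ℤ^T` and the coordinates of its elements are values at fixed elements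
`p t` of functionals on `B`, then the rank of `L` is at most that of `B`. -/
theorem rank_le_of_functionals {L B : Type w} [AddCommGroup L] [AddCommGroup B] {T : Type*}
    [Finite T] (φ : L →+ (T → ℤ)) (hφ : Function.Injective φ) (p : T → B)
    (h : ∀ l : L, ∃ f : B →+ ℤ, ∀ t, f (p t) = φ l t) :
    Module.rank ℚ (ℚ ⊗[ℤ] L) ≤ Module.rank ℚ (ℚ ⊗[ℤ] B) := by
  classical
  have := Fintype.ofFinite T
  -- The rational space of `B` may be infinite-dimensional; only the finite-dimensional span of the
  -- `p t` matters, and its dual can be counted.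
  let W : Submodule ℚ (ℚ ⊗[ℤ] B) := Submodule.span ℚ (Set.range fun t => 1 ⊗ₜ[ℤ] p t)
  have hW : Module.Finite ℚ W := Module.Finite.span_of_finite ℚ (Set.finite_range _)
  let q (t : T) : W := ⟨1 ⊗ₜ[ℤ] p t, Submodule.subset_span ⟨t, rfl⟩⟩
  let ev : Module.Dual ℚ W →ₗ[ℚ] (T → ℚ) :=
    LinearMap.pi fun t => Module.Dual.eval ℚ W (q t)
  let Φ : ℚ ⊗[ℤ] L →ₗ[ℚ] (T → ℚ) :=
    (TensorProduct.piScalarRight ℤ ℚ ℚ T).toLinearMap.comp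
      (LinearMap.baseChange ℚ φ.toIntLinearMap)
  have hΦ : Function.Injective Φ := by
    refine (TensorProduct.piScalarRight ℤ ℚ ℚ T).injective.comp ?_
    exact Module.Flat.lTensor_preserves_injective_linearMap (M := ℚ) φ.toIntLinearMap hφ
  -- The coordinate vector of `l` comes from a functional on `B`, hence from the dual of `W`; these
  -- vectors span the range of `Φ`.
  have hrange : LinearMap.range Φ ≤ LinearMap.range ev := by
    rintro _ ⟨x, rfl⟩
    induction x using TensorProduct.induction_on with
    | zero => rw [map_zero]; exact Submodule.zero_mem _
    | add x y hx hy => rw [map_add]; exact Submodule.add_mem _ hx hy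
    | tmul a l =>
      obtain ⟨f, hf⟩ := h l
      let F : ℚ ⊗[ℤ] B →ₗ[ℚ] ℚ := (TensorProduct.AlgebraTensorModule.rid ℤ ℚ ℚ).toLinearMap.comp
        (LinearMap.baseChange ℚ f.toIntLinearMap)
      refine ⟨a • F.domRestrict W, ?_⟩
      ext t
      simp [ev, Φ, F, q, hf, mul_comm]
  have h1 : Module.rank ℚ (ℚ ⊗[ℤ] L) = Module.finrank ℚ (ℚ ⊗[ℤ] L) := by
    have : Module.Finite ℚ (ℚ ⊗[ℤ] L) := Module.Finite.of_injective Φ hΦ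
    exact (Module.finrank_eq_rank ℚ _).symm
  have h2 : Module.finrank ℚ (ℚ ⊗[ℤ] L) ≤ Module.finrank ℚ W := by
    rw [← LinearMap.finrank_range_of_inj hΦ]
    refine (Submodule.finrank_mono hrange).trans ((LinearMap.finrank_range_le ev).trans ?_)
    rw [Subspace.dual_finrank_eq]
  calc Module.rank ℚ (ℚ ⊗[ℤ] L) ≤ (Module.finrank ℚ W : Cardinal) := by
        rw [h1]; exact_mod_cast h2
    _ = Module.rank ℚ W := Module.finrank_eq_rank ℚ _
    _ ≤ _ := Submodule.rank_le _

end LinearAlgebra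


/-! ### The rank inequality -/

section Rank

open scoped TensorProduct

variable (K : Type v) [Field K] {Γ : Type u} [Group Γ]

theorem rkG_resGf (H : Subgroup Γ) [Finite H] {e : MonoidAlgebra K H} (he : IsIdempotentElem e)
    (x : Gf K (MonoidAlgebra K Γ)) :
    rkG K he (resGf K H x) =
      rkHom K _ (fun _ h => h) (he.map (MonoidAlgebra.mapDomainAlgHom K K H.subtype)) x := by
  refine GrothGroup.induction (f := (rkG K he).comp (resGf K H)) ?_ x
  intro M hM
  rw [AddMonoidHom.comp_apply, resGf, GrothGroup.restrict_cls, rkG_cls, rkHom,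
    GrothGroup.lift_cls]
  exact_mod_cast rk_restrictScalars K (MonoidAlgebra.mapDomainAlgHom K K H.subtype) M e

theorem rank_range_j_le [CharZero K] (hFCP : FCP Γ) (F : FiniteFamily Γ) :
    Module.rank ℚ (ℚ ⊗[ℤ] (j K F).range) ≤
      Module.rank ℚ (ℚ ⊗[ℤ] K0 (MonoidAlgebra K Γ)) := by
  obtain ⟨S, hS, hSconj⟩ := hFCP
  have hsemi (H : F.carrier) : IsSemisimpleRing (MonoidAlgebra K H.1) := by
    -- Maschke's theorem needs the order of the group to be invertible.
    have : NeZero (Nat.card H.1 : K) := ⟨Nat.cast_ne_zero.2 Nat.card_pos.ne'⟩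
    infer_instance
  choose E hEfin hE hE' using fun H : F.carrier =>
    exists_finite_idempotents (MonoidAlgebra K H.1)
  let I := {H : F.carrier // H.1 ∈ S}
  have : Finite I := by
    have := hS.to_subtype
    exact Finite.of_injective (fun H : I => (⟨H.1.1, H.2⟩ : S))
      fun a b h => Subtype.ext (Subtype.ext (Subtype.mk.inj h))
  have (H : F.carrier) : Finite (E H) := (hEfin H).to_subtype
  let T := Σ H : I, E H.1
  let φ : (j K F).range →+ (T → ℤ) := AddMonoidHom.pi fun t =>
    (rkG K (hE t.1.1 t.2.1 t.2.2).1).comp ((Pi.evalAddMonoidHom _ t.1.1).comp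
      ((GLim K F).subtype.comp (j K F).range.subtype))
  -- The fixed elements of `K0` are the classes `[K[Γ]e]`, with `e` pushed forward from `K[H]` to
  -- `K[Γ]`.
  refine rank_le_of_functionals φ ?_ (fun t => idemCls ((hE t.1.1 t.2.1 t.2.2).1.map
    (MonoidAlgebra.mapDomainAlgHom K K t.1.1.1.subtype))) ?_
  · rw [injective_iff_map_eq_zero]
    intro x hx
    have hzero (H : F.carrier) (hH : H.1 ∈ S) : x.1.1 H = 0 :=
      eq_zero_of_rkG_eq_zero K (hE H) (hE' H) _ fun e he => congrFun hx ⟨⟨H, hH⟩, e, he⟩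
    refine Subtype.ext (Subtype.ext (funext fun H => ?_))
    obtain ⟨L, hL, γ, hγ⟩ := hSconj H.1 (F.finite H.1 H.2)
    have hmem : (F.conj γ⁻¹ H).1 ∈ S := by
      convert hL
      change H.1.map (MulAut.conj γ⁻¹).toMonoidHom = L
      rw [hγ, Subgroup.map_map]
      convert Subgroup.map_id L
      ext g
      simp [mul_assoc]
    -- The component at `H` is pulled back from that of a conjugate in `S`, which vanishes.
    have h := x.1.2.2 γ⁻¹ H
    rw [hzero _ hmem, map_zero] at h
    exact h.symm
  · rintro ⟨_, ⟨⟨_, z, rfl⟩, rfl⟩⟩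
    obtain ⟨f, hf⟩ := exists_functional K z
    exact ⟨f, fun t => (hf _ _).trans (rkG_resGf K t.1.1.1 (hE t.1.1 t.2.1 t.2.2).1 z).symm⟩

end Rank

/-! ### Torsion-freeness from `K0 ≅ ℤ` -/

section Torsion

variable {Γ : Type u} [Group Γ]

/-- The group ring of a finite group `Q` as a module over `K[Γ]`, along `Γ → Q`. -/
noncomputable abbrev quotModule (K : Type v) [Field K] {Q : Type u} [Group Q] (π : Γ →* Q) :
    ModuleCat.{max u v} (MonoidAlgebra K Γ) :=
  (ModuleCat.restrictScalars
    (MonoidAlgebra.mapDomainAlgHom K K π : MonoidAlgebra K Γ →+* MonoidAlgebra K Q)).obj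
      (ModuleCat.of (MonoidAlgebra K Q) (MonoidAlgebra K Q))

theorem quotModule_finite (K : Type v) [Field K] {Q : Type u} [Group Q] [Finite Q] (π : Γ →* Q) :
    Module.Finite K ((ModuleCat.restrictScalars (algebraMap K (MonoidAlgebra K Γ))).obj
      (quotModule K π)) := by
  have h : Module.Finite K ((ModuleCat.restrictScalars (algebraMap K (MonoidAlgebra K Q))).obj
      (ModuleCat.of (MonoidAlgebra K Q) (MonoidAlgebra K Q))) :=
    finite_base_of_finite K _ (inferInstanceAs (Module.Finite (MonoidAlgebra K Q) _))
  have hcomp : algebraMap K (MonoidAlgebra K Q) = ((MonoidAlgebra.mapDomainAlgHom K K π :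
      MonoidAlgebra K Γ →+* MonoidAlgebra K Q)).comp (algebraMap K (MonoidAlgebra K Γ)) :=
    (MonoidAlgebra.mapDomainAlgHom K K π).comp_algebraMap.symm
  rw [hcomp] at h
  exact h

/-- An idempotent of a finite-dimensional algebra acts with full rank only if it is `1`. -/
theorem rk_self_eq_iff (K : Type v) [Field K] {A : Type w} [Ring A] [Algebra K A]
    [Module.Finite K A] (e : A) :
    rk K e (ModuleCat.of A A) = rk K 1 (ModuleCat.of A A) ↔ e = 1 := by
  refine ⟨fun h => ?_, fun h => by rw [h]⟩
  let _ := baseModule K (ModuleCat.of A A)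
  have := baseModule_isScalarTower K (ModuleCat.of A A)
  have : Module.Finite K (ModuleCat.of A A) :=
    finite_base_of_finite K (ModuleCat.of A A) (inferInstanceAs (Module.Finite A A))
  have h1 : fixedSub K (ModuleCat.of A A) (1 : A) = ⊤ :=
    eq_top_iff.2 fun m _ => one_smul A m
  have h2 : fixedSub K (ModuleCat.of A A) e = ⊤ := by
    refine Submodule.eq_top_of_finrank_eq (h.trans ?_)
    change Module.finrank K (fixedSub K (ModuleCat.of A A) (1 : A)) = _
    rw [h1, finrank_top]
  -- Full rank means that `e` fixes every element of `A`; it is then evaluated at `1`.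
  have h3 : (1 : A) ∈ fixedSub K (ModuleCat.of A A) e := h2 ▸ Submodule.mem_top
  exact (mul_one e).symm.trans h3

/-- The averaging idempotent of the cyclic group generated by `γ`. -/
noncomputable def avg (K : Type v) [Field K] (γ : Γ) : MonoidAlgebra K Γ :=
  (orderOf γ : K)⁻¹ • ∑ i ∈ Finset.range (orderOf γ), MonoidAlgebra.single (γ ^ i) (1 : K)

/-- Multiplication by `γ` permutes the powers cyclically. For `γ` of infinite order `orderOf γ` is
`0`, and both sides are `0`. -/
theorem single_mul_avg (K : Type v) [Field K] (γ : Γ) :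
    MonoidAlgebra.single γ (1 : K) * avg K γ = avg K γ := by
  rw [avg, mul_smul_comm, Finset.mul_sum]
  congr 1
  simp only [MonoidAlgebra.single_mul_single, ← pow_succ', one_mul]
  -- Splitting off the first or the last term of the longer sum removes the same element, as `γ ^
  -- orderOf γ = γ ^ 0`.
  have h1 := Finset.sum_range_succ (fun i => MonoidAlgebra.single (γ ^ i) (1 : K)) (orderOf γ)
  rw [Finset.sum_range_succ', pow_orderOf_eq_one, pow_zero] at h1
  exact add_right_cancel h1

theorem isIdempotentElem_avg (K : Type v) [Field K] [CharZero K] {γ : Γ} (hγ : IsOfFinOrder γ) :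
    IsIdempotentElem (avg K γ) := by
  have h (i : ℕ) : MonoidAlgebra.single (γ ^ i) (1 : K) * avg K γ = avg K γ := by
    induction i with
    | zero => rw [pow_zero, ← MonoidAlgebra.one_def, one_mul]
    | succ i ih =>
      rw [pow_succ, ← one_mul (1 : K), ← MonoidAlgebra.single_mul_single, mul_assoc,
        single_mul_avg, ih]
  change avg K γ * avg K γ = avg K γ
  conv_lhs => enter [1]; rw [avg]
  rw [smul_mul_assoc, Finset.sum_mul, Finset.sum_congr rfl fun i _ => h i, Finset.sum_const,
    Finset.card_range, ← Nat.cast_smul_eq_nsmul K, smul_smul,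
    inv_mul_cancel₀ (Nat.cast_ne_zero.2 hγ.orderOf_pos.ne'), one_smul]

theorem torsionFree_of_K0_equiv_int (K : Type v) [Field K] [CharZero K]
    (hVTF : VirtuallyTorsionFree Γ) (ψ : K0 (MonoidAlgebra K Γ) ≃+ ℤ) : TorsionFree Γ := by
  intro γ hγ
  obtain ⟨Γ', hfin, htf⟩ := hVTF
  have he := isIdempotentElem_avg K hγ
  have h1 : IsIdempotentElem (1 : MonoidAlgebra K Γ) := IsIdempotentElem.one
  have hval {Q : Type u} [Group Q] [Finite Q] (π : Γ →* Q) {e : MonoidAlgebra K Γ}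
      (he : IsIdempotentElem e) :
      homDim K (quotModule K π) (quotModule_finite K π) (idemCls he) =
        rk K (MonoidAlgebra.mapDomainAlgHom K K π e)
          (ModuleCat.of (MonoidAlgebra K Q) (MonoidAlgebra K Q)) := by
    rw [homDim_idemCls, rk_restrictScalars]
  -- A functional on an infinite cyclic group is a multiple of `ψ`, so one with a nonzero value is
  -- injective.
  have hmul (f : K0 (MonoidAlgebra K Γ) →+ ℤ) (p : K0 (MonoidAlgebra K Γ)) :
      f p = ψ p * f (ψ.symm 1) := by
    have : p = ψ p • ψ.symm 1 := by
      rw [← map_zsmul, smul_eq_mul, mul_one, AddEquiv.symm_apply_apply]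
    conv_lhs => rw [this]
    rw [map_zsmul, smul_eq_mul]
  -- the trivial representation does not distinguish the two classes
  have heq : idemCls he = idemCls h1 := by
    let π : Γ →* PUnit.{u + 1} := 1
    let f := homDim K (quotModule K π) (quotModule_finite K π)
    have hpi : MonoidAlgebra.mapDomainAlgHom K K π (avg K γ) = 1 := by
      rw [avg, map_smul, map_sum]
      simp only [MonoidAlgebra.mapDomainAlgHom_apply, MonoidAlgebra.mapDomain_single, π,
        MonoidHom.one_apply]
      rw [Finset.sum_const, Finset.card_range, ← Nat.cast_smul_eq_nsmul K, smul_smul,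
        inv_mul_cancel₀ (Nat.cast_ne_zero.2 hγ.orderOf_pos.ne'), one_smul]
      rfl
    have hf : f (idemCls he) = f (idemCls h1) := by
      rw [hval, hval, hpi, map_one]
    have hne : f (idemCls h1) ≠ 0 := by
      rw [hval, map_one]
      exact_mod_cast (rk_ne_zero_iff K _ (finite_base_of_finite K
        (ModuleCat.of (MonoidAlgebra K PUnit.{u + 1}) (MonoidAlgebra K PUnit.{u + 1}))
        (inferInstanceAs (Module.Finite (MonoidAlgebra K PUnit.{u + 1}) _))) _).2
        ⟨(1 : MonoidAlgebra K PUnit.{u + 1}), one_ne_zero, one_smul _ _⟩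
    rw [hmul f, hmul f (idemCls h1)] at hf
    rw [hmul f] at hne
    exact ψ.injective (mul_right_cancel₀ (right_ne_zero_of_mul hne) hf)
  -- The normal core still has finite index, so this quotient is finite, and it is contained in the
  -- torsion-free `Γ'`.
  let π := QuotientGroup.mk' Γ'.normalCore
  have hrk := congrArg (homDim K (quotModule K π) (quotModule_finite K π)) heq
  rw [hval, hval, map_one, Nat.cast_inj, rk_self_eq_iff] at hrk
  -- With `avg K γ ↦ 1`, the relation `γ · avg = avg` says that `γ` becomes trivial in the quotient.
  have hone := congrArg (MonoidAlgebra.mapDomainAlgHom K K π) (single_mul_avg K γ)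
  rw [map_mul, hrk, mul_one, MonoidAlgebra.mapDomainAlgHom_apply, MonoidAlgebra.mapDomain_single,
    MonoidAlgebra.one_def] at hone
  have hmem : γ ∈ Γ'.normalCore :=
    (QuotientGroup.eq_one_iff γ).1 (MonoidAlgebra.single_left_injective one_ne_zero hone)
  have hmem' := Γ'.normalCore_le hmem
  exact congrArg Subtype.val (htf ⟨γ, hmem'⟩ (Submonoid.isOfFinOrder_coe.1 hγ))

end Torsion

end DiscreteGroupK

open scoped TensorProduct in
theorem proposition4p1 {Γ : Type u} [Group Γ] (hFCP : DiscreteGroupK.FCP Γ)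
    (hVTF : DiscreteGroupK.VirtuallyTorsionFree Γ) :
    (∀ (𝕂 : Type v) [Field 𝕂] [CharZero 𝕂] (F : DiscreteGroupK.FiniteFamily Γ),
      Module.rank ℚ (ℚ ⊗[ℤ] (DiscreteGroupK.j 𝕂 F).range) ≤
        Module.rank ℚ (ℚ ⊗[ℤ] DiscreteGroupK.K0 (MonoidAlgebra 𝕂 Γ))) ∧
    (Nonempty (DiscreteGroupK.K0 (MonoidAlgebra ℂ Γ) ≃+ ℤ) → DiscreteGroupK.TorsionFree Γ) :=
  ⟨fun 𝕂 _ _ F => DiscreteGroupK.rank_range_j_le 𝕂 hFCP F,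
    fun ⟨ψ⟩ => DiscreteGroupK.torsionFree_of_K0_equiv_int ℂ hVTF ψ⟩
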